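/- For $e\in\mathbb N$ let $\Phi_e:\subseteq\mathbb N^{\mathbb N}\to\mathbb N^{\mathbb N}$ be the $e$-th Turing functional, and let $e^\smallfrown q$ be the sequence $q$ with $e$ prepended. A partial multi-valued function $f$ on $\mathbb N^{\mathbb N}$ assigns to each $p\in\mathbb N^{\mathbb N}$ a set $f(p)\subseteq\mathbb N^{\mathbb N}$; $\operatorname{dom}(f)=\{p: f(p)\neq\emptyset\}$. Write $f\le_{\mathrm W}g$ ($f$ is Weihrauch reducible to $g$) if there are computable functionals $\Phi:\subseteq\mathbb N^{\mathbb N}\to\mathbb N^{\mathbb N}$ and $\Psi:\subseteq\mathbb N^{\mathbb N}\times\mathbb N^{\mathbb N}\to\mathbb N^{\mathbb N}$ such that for all $p\in\operatorname{dom}(f)$ we have $\Phi(p)\in\operatorname{dom}(g)$ and $\Psi(p,q)\in f(p)$ for all $q\in g(\Phi(p))$; write $f\equiv_{\mathrm W}g$ if $f\le_{\mathrm W}g\le_{\mathrm W}f$, and $f<_{\mathrm W}g$ if $f\le_{\mathrm W}g$ and $g\not\le_{\mathrm W}f$. We say that $f$ is a strong minimal cover of $h$ in the Weihrauch degrees if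 $h<_{\mathrm W}f$ and every $g<_{\mathrm W}f$ satisfies $g\le_{\mathrm W}h$. Let $\operatorname{id}$ be the identity function on $\mathbb N^{\mathbb N}$, $\operatorname{id}|_A$ its restriction to $A\subseteq\mathbb N^{\mathbb N}$, and for $p\in\mathbb N^{\mathbb N}$ let $$\{p\}^+:=\{e^\smallfrown q : \Phi_e(q)=p \text{ and } q\not\le_{\mathrm T}p\}.$$ **Theorem.** Let $f$, $g$ and $h$ be partial multi-valued functions on $\mathbb N^{\mathbb N}$. 1. $f$ is a strong minimal cover of $h$ in the Weihrauch degrees if and only if there is $p\in\mathbb N^{\mathbb N}$ such that $f\equiv_{\mathrm W}\operatorname{id}|_{\{p\}}$ and $h\equiv_{\mathrm W}\operatorname{id}|_{\{p\}^+}$. 2. If $f$ is a strong minimal cover of $h$, then $f\le_{\mathrm W}\operatorname{id}$. 3. If $f$ and $g$ are both strong minimal covers of $h$, then $f\equiv_{\mathrm W}g$; that is, every Weihrauch degree has at most one strong minimal cover. -/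

import Mathlib

namespace Weihrauch

/-- Baire space `ℕ^ℕ`. -/
abbrev Baire : Type := ℕ → ℕ

/-! ### Oracle computations

Programs for partial recursive functions with an oracle. The constructors are exactly the
closure conditions of `Nat.RecursiveIn`, with a single total oracle. -/

/-- Programs with access to an oracle. -/
inductive OracleCode : Type
  | zero : OracleCode
  | succ : OracleCode
  | left : OracleCode
  | right : OracleCode
  | oracle : OracleCode
  | pair : OracleCode → OracleCode → OracleCode
  | comp : OracleCode → OracleCode → OracleCode
  | prec : OracleCode → OracleCode → OracleCode
  | rfind : OracleCode → OracleCode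

namespace OracleCode

/-- The partial function `ℕ ⇀ ℕ` that a program computes with oracle `q`. -/
def eval (q : Baire) : OracleCode → ℕ →. ℕ
  | zero => fun _ => Part.some 0
  | succ => fun n => Part.some (n + 1)
  | left => fun n => Part.some n.unpair.1
  | right => fun n => Part.some n.unpair.2
  | oracle => fun n => Part.some (q n)
  | pair c d => fun n => Nat.pair <$> eval q c n <*> eval q d n
  | comp c d => fun n => eval q d n >>= eval q c
  | prec c d => fun n =>
      Nat.rec (motive := fun _ => Part ℕ) (eval q c n.unpair.1)
        (fun y IH => IH >>= fun i => eval q d (Nat.pair n.unpair.1 (Nat.pair y i)))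
        n.unpair.2
  | rfind c => fun n =>
      Nat.rfind fun k => (fun m => decide (m = 0)) <$> eval q c (Nat.pair n k)

/-- The program with number `e`: an effective numbering of all programs by `ℕ`. -/
def ofNat : ℕ → OracleCode
  | 0 => zero
  | 1 => succ
  | 2 => left
  | 3 => right
  | 4 => oracle
  | n + 5 =>
    have hm : n / 4 < n + 5 := by omega
    have _h₁ : (n / 4).unpair.1 < n + 5 := lt_of_le_of_lt (Nat.unpair_left_le _) hm
    have _h₂ : (n / 4).unpair.2 < n + 5 := lt_of_le_of_lt (Nat.unpair_right_le _) hm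
    match n % 4 with
    | 0 => pair (ofNat (n / 4).unpair.1) (ofNat (n / 4).unpair.2)
    | 1 => comp (ofNat (n / 4).unpair.1) (ofNat (n / 4).unpair.2)
    | 2 => prec (ofNat (n / 4).unpair.1) (ofNat (n / 4).unpair.2)
    | _ => rfind (ofNat (n / 4))

end OracleCode

/-- The `e`-th Turing functional `Φ_e`, a partial function on Baire space: `Φ_e(q)` is defined
when the `e`-th program with oracle `q` halts on every input, and it is then the sequence of
the outputs. -/
def Phi (e : ℕ) : Baire →. Baire := fun q =>
  ⟨∀ n, ((OracleCode.ofNat e).eval q n).Dom, fun h n => ((OracleCode.ofNat e).eval q n).get (h n)⟩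

/-- Computable functionals `ℕ^ℕ ⇀ ℕ^ℕ`. -/
def ComputableFunctional (F : Baire →. Baire) : Prop := ∃ e, F = Phi e

/-- The standard pairing of Baire space: `p` on the even places, `q` on the odd ones. -/
def join (p q : Baire) : Baire := fun n => if n % 2 = 0 then p (n / 2) else q (n / 2)

/-- Computable functionals `ℕ^ℕ × ℕ^ℕ ⇀ ℕ^ℕ`. -/
def ComputableFunctional₂ (F : Baire × Baire →. Baire) : Prop :=
  ∃ e, ∀ p q, F (p, q) = Phi e (join p q)

/-- Turing reducibility between elements of Baire space. -/
def TuringLE (q p : Baire) : Prop := TuringReducible (q : ℕ →. ℕ) (p : ℕ →. ℕ)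

/-! ### Problems and Weihrauch reducibility -/

/-- Partial multi-valued functions on Baire space; `f p` is the set of values at `p`, and it is
empty precisely when `p` is outside the domain. -/
def Problem : Type := Baire → Set Baire

/-- The domain of a partial multi-valued function. -/
def Problem.dom (f : Problem) : Set Baire := {p | (f p).Nonempty}

/-- Weihrauch reducibility `f ≤_W g`. -/
def WLE (f g : Problem) : Prop :=
  ∃ (F : Baire →. Baire) (G : Baire × Baire →. Baire),
    ComputableFunctional F ∧ ComputableFunctional₂ G ∧
    ∀ p ∈ f.dom, ∃ x ∈ F p, x ∈ g.dom ∧ ∀ q ∈ g x, ∃ y ∈ G (p, q), y ∈ f p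

/-- Weihrauch equivalence: `f` and `g` have the same Weihrauch degree. -/
def WEquiv (f g : Problem) : Prop := WLE f g ∧ WLE g f

/-- Strict Weihrauch reducibility: the degree of `f` is strictly below that of `g`. -/
def WLT (f g : Problem) : Prop := WLE f g ∧ ¬ WLE g f

/-- The degree of `f` is a strong minimal cover of the degree of `h`. -/
def IsStrongMinimalCover (f h : Problem) : Prop :=
  WLT h f ∧ ∀ g : Problem, WLT g f → WLE g h

/-- The identity on Baire space. -/
def idProblem : Problem := fun p => {p}

/-- The restriction of the identity to `A`, a problem with domain `A`. -/
def idOn (A : Set Baire) : Problem := fun p => {q | p ∈ A ∧ q = p}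

/-- The sequence `e⌢q`. -/
def cons (e : ℕ) (q : Baire) : Baire
  | 0 => e
  | n + 1 => q n

/-- `{p}^+ = {e⌢q : Φ_e(q) = p and q is not Turing reducible to p}`. -/
def medvedevSucc (p : Baire) : Set Baire :=
  {r | ∃ (e : ℕ) (q : Baire), r = cons e q ∧ p ∈ Phi e q ∧ ¬ TuringLE q p}

end Weihrauch

/-! Let `f` be a strong minimal cover of `h`. Any problem below `f` but not below `h` is then
equivalent to `f`. Diagonalising against all pairs of functionals yields such a problem `g`, with
one instance `n⌢p_n` for each pair coded by `n`: the instance `p_n` of `f` defeats the pair, and the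
solution set is enlarged to a set `B_n` that omits at most the single output responsible for the
failure. Hence `B_n` contains one of the two constant sequences 0 and 1. If every restriction of `g`
to a single `n` were below `h`, a sufficiently generic `A ⊆ ℕ` would give a restriction that is not
below `h` and not above `g`, which is impossible. So a restriction to one `n` is equivalent to `f`.
It has one instance and a computable solution, so it is equivalent to the identity on a point.

Conversely, if `g` is strictly below `id|_{p}`, each of its instances computes `p` through one fixed
`Φ_e` and is not computable from `p`. Prepending `e` sends these instances into `{p}^+`.

For uniqueness, `id|_{p}^+ ≤ id|_{p'}^+` gives one functional that computes `p'` from `p ⊕ r` for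
every `r` not computable from `p`. Each finite string extends to such an `r`, so `p` can search over
strings and trust any answer: `p' ≤_T p`. The search rests on the use principle and a step-bounded
simulation with finite oracles. -/

namespace Weihrauch

/-! ### Oracle programs: numbering and substitution. -/

namespace OracleCode

theorem ofNat_pair (m : ℕ) :
    ofNat (4 * m + 5) = pair (ofNat m.unpair.1) (ofNat m.unpair.2) := by
  have h1 : 4 * m / 4 = m := by omega
  have h2 : 4 * m % 4 = 0 := by omega
  rw [ofNat, h1]; simp only [h2]

theorem ofNat_comp (m : ℕ) :
    ofNat (4 * m + 1 + 5) = comp (ofNat m.unpair.1) (ofNat m.unpair.2) := by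
  have h1 : (4 * m + 1) / 4 = m := by omega
  have h2 : (4 * m + 1) % 4 = 1 := by omega
  rw [ofNat, h1]; simp only [h2]

theorem ofNat_prec (m : ℕ) :
    ofNat (4 * m + 2 + 5) = prec (ofNat m.unpair.1) (ofNat m.unpair.2) := by
  have h1 : (4 * m + 2) / 4 = m := by omega
  have h2 : (4 * m + 2) % 4 = 2 := by omega
  rw [ofNat, h1]; simp only [h2]

theorem ofNat_rfind (m : ℕ) : ofNat (4 * m + 3 + 5) = rfind (ofNat m) := by
  have h1 : (4 * m + 3) / 4 = m := by omega
  have h2 : (4 * m + 3) % 4 = 3 := by omega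
  rw [ofNat, h1]; simp only [h2]

theorem exists_ofNat (c : OracleCode) : ∃ n, ofNat n = c := by
  induction c with
  | zero => exact ⟨0, by rw [ofNat]⟩
  | succ => exact ⟨1, by rw [ofNat]⟩
  | left => exact ⟨2, by rw [ofNat]⟩
  | right => exact ⟨3, by rw [ofNat]⟩
  | oracle => exact ⟨4, by rw [ofNat]⟩
  | pair c d hc hd =>
    obtain ⟨a, rfl⟩ := hc
    obtain ⟨b, rfl⟩ := hd
    exact ⟨_, by rw [ofNat_pair (Nat.pair a b), Nat.unpair_pair]⟩
  | comp c d hc hd =>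
    obtain ⟨a, rfl⟩ := hc
    obtain ⟨b, rfl⟩ := hd
    exact ⟨_, by rw [ofNat_comp (Nat.pair a b), Nat.unpair_pair]⟩
  | prec c d hc hd =>
    obtain ⟨a, rfl⟩ := hc
    obtain ⟨b, rfl⟩ := hd
    exact ⟨_, by rw [ofNat_prec (Nat.pair a b), Nat.unpair_pair]⟩
  | rfind c hc =>
    obtain ⟨a, rfl⟩ := hc
    exact ⟨_, ofNat_rfind a⟩

/-- Replace every oracle query by a call of the program `d`. -/
def subst (d : OracleCode) : OracleCode → OracleCode
  | zero => zero
  | succ => succ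
  | left => left
  | right => right
  | oracle => d
  | pair a b => pair (subst d a) (subst d b)
  | comp a b => comp (subst d a) (subst d b)
  | prec a b => prec (subst d a) (subst d b)
  | rfind a => rfind (subst d a)

theorem eval_subst {d : OracleCode} {x y : Baire} (h : ∀ n, d.eval x n = Part.some (y n))
    (c : OracleCode) : (subst d c).eval x = c.eval y := by
  induction c with
  | oracle => funext n; exact h n
  | pair a b ha hb => simp only [subst, eval, ha, hb]; rfl
  | comp a b ha hb => simp only [subst, eval, ha, hb]; rfl
  | prec a b ha hb => simp only [subst, eval, ha, hb]; rfl
  | rfind a ha => simp only [subst, eval, ha]; rfl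
  | _ => rfl

theorem exists_eval_eq_of_partrec {f : ℕ →. ℕ} (hf : Nat.Partrec f) :
    ∃ c : OracleCode, ∀ q, c.eval q = f := by
  induction hf with
  | zero => exact ⟨zero, fun _ => rfl⟩
  | succ => exact ⟨succ, fun _ => rfl⟩
  | left => exact ⟨left, fun _ => rfl⟩
  | right => exact ⟨right, fun _ => rfl⟩
  | pair _ _ hc hd =>
    obtain ⟨c, hc⟩ := hc
    obtain ⟨d, hd⟩ := hd
    exact ⟨pair c d, fun q => by simp only [eval, hc, hd]; rfl⟩
  | comp _ _ hc hd =>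
    obtain ⟨c, hc⟩ := hc
    obtain ⟨d, hd⟩ := hd
    exact ⟨comp c d, fun q => by simp only [eval, hc, hd]; rfl⟩
  | prec _ _ hc hd =>
    obtain ⟨c, hc⟩ := hc
    obtain ⟨d, hd⟩ := hd
    exact ⟨prec c d, fun q => by simp only [eval, hc, hd]; rfl⟩
  | rfind _ hc =>
    obtain ⟨c, hc⟩ := hc
    exact ⟨rfind c, fun q => by simp only [eval, hc]; rfl⟩

end OracleCode

/-! ### Functions computed uniformly in the oracle. -/

open OracleCode

/-- Total functions `ℕ → ℕ` computed by one program from all oracles. -/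
def UniformlyComputable (f : Baire → ℕ → ℕ) : Prop :=
  ∃ c : OracleCode, ∀ q n, c.eval q n = Part.some (f q n)

namespace UniformlyComputable

theorem of_primrec {g : ℕ → ℕ} (hg : Primrec g) : UniformlyComputable fun _ n => g n := by
  obtain ⟨c, hc⟩ := exists_eval_eq_of_partrec (Nat.Partrec.of_primrec (Primrec.nat_iff.1 hg))
  exact ⟨c, fun q n => by rw [hc]; rfl⟩

theorem comp {f g : Baire → ℕ → ℕ} (hf : UniformlyComputable f) (hg : UniformlyComputable g) :
    UniformlyComputable fun q n => f q (g q n) := by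
  obtain ⟨c, hc⟩ := hf
  obtain ⟨d, hd⟩ := hg
  exact ⟨.comp c d, fun q n => 
    (congrArg (· >>= eval q c) (hd q n)).trans ((Part.bind_some _ _).trans (hc _ _))⟩

theorem oracle {g : Baire → ℕ → ℕ} (hg : UniformlyComputable g) :
    UniformlyComputable fun q n => q (g q n) :=
  comp (f := fun q n => q n) ⟨.oracle, fun _ _ => rfl⟩ hg

theorem pair {f g : Baire → ℕ → ℕ} (hf : UniformlyComputable f) (hg : UniformlyComputable g) :
    UniformlyComputable fun q n => Nat.pair (f q n) (g q n) := by
  obtain ⟨c, hc⟩ := hf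
  obtain ⟨d, hd⟩ := hg
  exact ⟨.pair c d, fun q n => by simp [eval, hc, hd, Seq.seq]⟩

theorem comp₂ {h : ℕ → ℕ → ℕ} {f g : Baire → ℕ → ℕ} (hh : Primrec₂ h)
    (hf : UniformlyComputable f) (hg : UniformlyComputable g) :
    UniformlyComputable fun q n => h (f q n) (g q n) := by
  have := comp (of_primrec (hh.comp (Primrec.fst.comp Primrec.unpair)
    (Primrec.snd.comp Primrec.unpair))) (hf.pair hg)
  simpa using this

theorem comp_primrec {h : ℕ → ℕ} {f : Baire → ℕ → ℕ} (hh : Primrec h)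
    (hf : UniformlyComputable f) : UniformlyComputable fun q n => h (f q n) :=
  comp (of_primrec hh) hf

theorem const (k : ℕ) : UniformlyComputable fun _ _ => k := of_primrec (Primrec.const k)

theorem id : UniformlyComputable fun _ n => n := of_primrec Primrec.id

end UniformlyComputable

/-- The first `k` values of `q`. -/
def initSeg (q : Baire) (k : ℕ) : List ℕ := (List.range k).map q

theorem uniformlyComputable_initSeg :
    UniformlyComputable fun q k => Encodable.encode (initSeg q k) := by
  -- The input is `⟨a, ⟨y, i⟩⟩`, as in primitive recursion: `i` codes the list built so far and `y`
  -- is the next position to query.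
  have hstep : UniformlyComputable fun q m =>
      Encodable.encode (Denumerable.ofNat (List ℕ) m.unpair.2.unpair.2 ++ [q m.unpair.2.unpair.1]) := by
    refine UniformlyComputable.comp₂
      (h := fun a b => Encodable.encode (Denumerable.ofNat (List ℕ) a ++ [b])) ?_
      (f := fun q m => m.unpair.2.unpair.2) ?_ (UniformlyComputable.oracle ?_)
    · exact Primrec.encode.comp (Primrec.list_append.comp ((Primrec.ofNat _).comp Primrec.fst)
        (Primrec.list_cons.comp Primrec.snd (Primrec.const [])))
    · exact .of_primrec (Primrec.snd.comp (Primrec.unpair.comp (Primrec.snd.comp Primrec.unpair)))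
    · exact .of_primrec (Primrec.fst.comp (Primrec.unpair.comp (Primrec.snd.comp Primrec.unpair)))
  obtain ⟨d, hd⟩ := hstep
  replace hd : ∀ q a y i, eval q d (Nat.pair a (Nat.pair y i)) =
      Part.some (Encodable.encode (Denumerable.ofNat (List ℕ) i ++ [q y])) := by
    intro q a y i; rw [hd]; simp
  have key : UniformlyComputable fun q n => Encodable.encode (initSeg q n.unpair.2) := by
    refine ⟨.prec .zero d, fun q n => ?_⟩
    simp only [eval]
    induction n.unpair.2 with
    | zero => rfl
    | succ k ih =>
      refine (congrArg (· >>= _) ih).trans ?_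
      simp [hd, initSeg, List.range_succ]
  have := key.comp ((UniformlyComputable.const 0).pair .id)
  simpa using this

/-! ### Finite oracles, the use principle and unbounded search. -/

theorem exists_lookupCode : ∃ L : Nat.Partrec.Code, ∀ (σ : List ℕ) (n : ℕ),
    (L.curry (Encodable.encode σ)).eval n = (σ[n]? : Part ℕ) := by
  have h : Partrec fun m : ℕ => (((Denumerable.ofNat (List ℕ) m.unpair.1)[m.unpair.2]? : Option ℕ)
      : Part ℕ) :=
    Computable.ofOption (Primrec.list_getElem?.comp
      ((Primrec.ofNat _).comp (Primrec.fst.comp Primrec.unpair))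
      (Primrec.snd.comp Primrec.unpair)).to_comp
  obtain ⟨L, hL⟩ := Nat.Partrec.Code.exists_code.1 (Partrec.nat_iff.1 h)
  refine ⟨L, fun σ n => ?_⟩
  rw [Nat.Partrec.Code.eval_curry, hL]
  simp

/-- A program for list lookup: `lookupCode.curry (encode σ)` computes `n ↦ σ[n]?`. -/
noncomputable def lookupCode : Nat.Partrec.Code := exists_lookupCode.choose

theorem eval_lookupCode (σ : List ℕ) (n : ℕ) :
    (lookupCode.curry (Encodable.encode σ)).eval n = (σ[n]? : Part ℕ) :=
  exists_lookupCode.choose_spec σ n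

namespace OracleCode

/-- Replace the oracle by the ordinary program `l`. -/
def toCode (l : Nat.Partrec.Code) : OracleCode → Nat.Partrec.Code
  | zero => .zero
  | succ => .succ
  | left => .left
  | right => .right
  | oracle => l
  | pair a b => .pair (toCode l a) (toCode l b)
  | comp a b => .comp (toCode l a) (toCode l b)
  | prec a b => .prec (toCode l a) (toCode l b)
  -- `rfind'` starts its search at the second component of its input, so the input is paired with 0.
  | rfind a => .comp (.rfind' (toCode l a)) (.pair .id .zero)

theorem primrec_toCode_ofNat : Primrec₂ fun l e => toCode l (ofNat e) := by
  -- Course-of-values recursion: `v` lists the translations of all smaller numbers, so its length is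
  -- the number being decoded.
  open Nat.Partrec Primrec in
  let g (l : Code) (v : List Code) : Option Code :=
    if v.length = 0 then some .zero else
    if v.length = 1 then some .succ else
    if v.length = 2 then some .left else
    if v.length = 3 then some .right else
    if v.length = 4 then some l else
    if (v.length - 5) % 4 = 3 then
      v[(v.length - 5) / 4]?.map fun a => .comp (.rfind' a) (.pair .id .zero) else
    v[((v.length - 5) / 4).unpair.1]?.bind fun a =>
    v[((v.length - 5) / 4).unpair.2]?.map fun b =>
      if (v.length - 5) % 4 = 0 then .pair a b else
      if (v.length - 5) % 4 = 1 then .comp a b else .prec a b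
  have hlen : Primrec fun p : Code × List Code => p.2.length := list_length.comp snd
  have hm : Primrec fun p : Code × List Code => p.2.length - 5 := nat_sub.comp hlen (const 5)
  have hd : Primrec fun p : Code × List Code => (p.2.length - 5) / 4 := nat_div.comp hm (const 4)
  have hr : Primrec fun p : Code × List Code => (p.2.length - 5) % 4 := nat_mod.comp hm (const 4)
  have hg : Primrec₂ g := by
    refine ite (Primrec.eq.comp hlen (const 0)) (const _) ?_
    refine ite (Primrec.eq.comp hlen (const 1)) (const _) ?_
    refine ite (Primrec.eq.comp hlen (const 2)) (const _) ?_
    refine ite (Primrec.eq.comp hlen (const 3)) (const _) ?_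
    refine ite (Primrec.eq.comp hlen (const 4)) (option_some.comp fst) ?_
    refine ite (Primrec.eq.comp hr (const 3)) ?_ ?_
    · refine option_map (list_getElem?.comp snd hd) ?_
      exact Code.primrec₂_comp.comp (Code.primrec_rfind'.comp snd) (const _)
    refine option_bind (list_getElem?.comp snd (fst.comp (unpair.comp hd))) ?_
    refine option_map (list_getElem?.comp (snd.comp fst)
      (snd.comp (unpair.comp (hd.comp fst)))) ?_
    have hr' : Primrec fun p : ((Code × List Code) × Code) × Code =>
      (p.1.1.2.length - 5) % 4 := hr.comp (fst.comp fst)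
    refine ite (Primrec.eq.comp hr' (const 0)) (Code.primrec₂_pair.comp (snd.comp fst) snd) ?_
    exact ite (Primrec.eq.comp hr' (const 1)) (Code.primrec₂_comp.comp (snd.comp fst) snd)
      (Code.primrec₂_prec.comp (snd.comp fst) snd)
  refine nat_strong_rec _ hg fun l n => ?_
  have hget : ∀ k < n, (List.map (fun e => toCode l (ofNat e)) (List.range n))[k]? =
      some (toCode l (ofNat k)) := by
    intro k hk; simp [hk]
  simp only [g, List.length_map, List.length_range]
  rcases Nat.lt_or_ge n 5 with h | h
  · interval_cases n <;> simp [ofNat, toCode]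
  obtain ⟨k, rfl⟩ : ∃ k, n = k + 5 := ⟨n - 5, by omega⟩
  obtain ⟨m, i, hi, rfl⟩ : ∃ m i, i < 4 ∧ k = 4 * m + i := ⟨k / 4, k % 4, by omega, by omega⟩
  have h1 : (4 * m + i) / 4 = m := by omega
  have h2 : (4 * m + i) % 4 = i := by omega
  have h3 := Nat.unpair_left_le m
  have h4 := Nat.unpair_right_le m
  simp only [Nat.add_sub_cancel, h1, h2]
  rw [hget m (by omega), hget _ (by omega), hget _ (by omega)]
  interval_cases i
  · simp [ofNat_pair, toCode]
  · simp [ofNat_comp, toCode]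
  · simp [ofNat_prec, toCode]
  · simp [ofNat_rfind, toCode]

/-- Primitive recursion from the partial functions `f` and `g`. -/
def precVal (f g : ℕ →. ℕ) (a k : ℕ) : Part ℕ :=
  Nat.rec (motive := fun _ => Part ℕ) (f a)
    (fun y IH => IH >>= fun i => g (Nat.pair a (Nat.pair y i))) k

theorem mem_precVal_succ {f g : ℕ →. ℕ} {a k m : ℕ} :
    m ∈ precVal f g a (k + 1) ↔ ∃ i ∈ precVal f g a k, m ∈ g (Nat.pair a (Nat.pair k i)) :=
  Part.mem_bind_iff

theorem mem_pair_seq {x y : Part ℕ} {m : ℕ} :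
    m ∈ (Nat.pair <$> x <*> y) ↔ ∃ a ∈ x, ∃ b ∈ y, Nat.pair a b = m := by
  simp [Seq.seq]

theorem mem_rfind_zero {f : ℕ → Part ℕ} {m : ℕ} :
    m ∈ Nat.rfind (fun k => (fun m => decide (m = 0)) <$> f k : ℕ →. Bool) ↔
      0 ∈ f m ∧ ∀ k < m, ∃ v ∈ f k, v ≠ 0 := by
  refine Nat.mem_rfind.trans ?_
  simp

variable {q : Baire} {a b : OracleCode} {l : Nat.Partrec.Code} {n m : ℕ}

theorem mem_eval_pair :
    m ∈ (pair a b).eval q n ↔ ∃ x ∈ a.eval q n, ∃ y ∈ b.eval q n, Nat.pair x y = m :=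
  mem_pair_seq

theorem mem_eval_comp :
    m ∈ (comp a b).eval q n ↔ ∃ x ∈ b.eval q n, m ∈ a.eval q x := Part.mem_bind_iff

theorem mem_eval_rfind : m ∈ (rfind a).eval q n ↔
    0 ∈ a.eval q (Nat.pair n m) ∧ ∀ k < m, ∃ v ∈ a.eval q (Nat.pair n k), v ≠ 0 :=
  mem_rfind_zero

theorem mem_toCode_pair : m ∈ (toCode l (pair a b)).eval n ↔
    ∃ x ∈ (toCode l a).eval n, ∃ y ∈ (toCode l b).eval n, Nat.pair x y = m :=
  mem_pair_seq

theorem mem_toCode_comp : m ∈ (toCode l (comp a b)).eval n ↔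
    ∃ x ∈ (toCode l b).eval n, m ∈ (toCode l a).eval x := Part.mem_bind_iff

theorem mem_toCode_rfind : m ∈ (toCode l (rfind a)).eval n ↔
    0 ∈ (toCode l a).eval (Nat.pair n m) ∧
      ∀ k < m, ∃ v ∈ (toCode l a).eval (Nat.pair n k), v ≠ 0 := by
  have h : (toCode l (rfind a)).eval n =
      Nat.rfind fun k => (fun m => decide (m = 0)) <$> (toCode l a).eval (Nat.pair n k) := by
    have h0 : (Nat.Partrec.Code.pair .id .zero).eval n = Part.some (Nat.pair n 0) := by
      refine Part.eq_some_iff.2 (mem_pair_seq.2 ⟨n, ?_, 0, ?_, rfl⟩)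
      · rw [Nat.Partrec.Code.eval_id]; exact Part.mem_some _
      · exact Part.mem_some _
    refine (congrArg (· >>= (Nat.Partrec.Code.rfind' (toCode l a)).eval) h0).trans
      ((Part.bind_some _ _).trans ?_)
    simp [Nat.Partrec.Code.eval, Part.map_id']
  rw [h]
  exact mem_rfind_zero

end OracleCode

/-- The finite string `σ` is extended by `q`. -/
def Agrees (σ : List ℕ) (q : Baire) : Prop := ∀ i a, σ[i]? = some a → q i = a

/-- The program for the oracle program `c` with finite oracle `σ`. -/
noncomputable def finCode (σ : List ℕ) (c : OracleCode) : Nat.Partrec.Code :=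
  toCode (lookupCode.curry (Encodable.encode σ)) c

/-- Lookup beyond the end of `σ` diverges, so a halting run has only used values on which `σ` and
`q` agree. -/
theorem mem_eval_of_mem_finCode {σ : List ℕ} {q : Baire} (hσ : Agrees σ q) (c : OracleCode) :
    ∀ {n m}, m ∈ (finCode σ c).eval n → m ∈ c.eval q n := by
  induction c with
  | oracle =>
    intro n m h
    rw [finCode, toCode, eval_lookupCode] at h
    have := hσ n m (by simpa using h)
    exact this ▸ Part.mem_some _
  | pair a b ha hb =>
    intro n m h
    obtain ⟨x, hx, y, hy, e⟩ := mem_toCode_pair.1 h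
    exact mem_eval_pair.2 ⟨x, ha hx, y, hb hy, e⟩
  | comp a b ha hb =>
    intro n m h
    obtain ⟨x, hx, hm⟩ := mem_toCode_comp.1 h
    exact mem_eval_comp.2 ⟨x, hb hx, ha hm⟩
  | prec a b ha hb =>
    intro n m
    change m ∈ precVal _ _ _ _ → m ∈ precVal _ _ _ _
    induction n.unpair.2 generalizing m with
    | zero => exact ha
    | succ k ih =>
      rw [mem_precVal_succ, mem_precVal_succ]
      exact fun ⟨i, hi, hm⟩ => ⟨i, ih hi, hb hm⟩
  | rfind a ha =>
    intro n m h
    obtain ⟨h0, hk⟩ := mem_toCode_rfind.1 h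
    exact mem_eval_rfind.2 ⟨ha h0, fun k hkm => (hk k hkm).imp fun v hv => ⟨ha hv.1, hv.2⟩⟩
  | _ => exact fun h => h

-- Use principle: a halting computation asks finitely many questions. Stating it for all large `k`
-- lets the subcomputations be combined by intersecting finitely many eventual conditions.
open Filter in
theorem eventually_mem_finCode {q : Baire} (c : OracleCode) :
    ∀ {n m}, m ∈ c.eval q n → ∀ᶠ k in atTop, m ∈ (finCode (initSeg q k) c).eval n := by
  induction c with
  | oracle =>
    intro n m h
    filter_upwards [eventually_gt_atTop n] with k hk
    rw [finCode, toCode, eval_lookupCode]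
    have : m = q n := Part.mem_some_iff.1 h
    simp [initSeg, hk, this]
  | pair a b ha hb =>
    intro n m h
    obtain ⟨x, hx, y, hy, e⟩ := mem_eval_pair.1 h
    filter_upwards [ha hx, hb hy] with k hx hy
    exact mem_toCode_pair.2 ⟨x, hx, y, hy, e⟩
  | comp a b ha hb =>
    intro n m h
    obtain ⟨x, hx, hm⟩ := mem_eval_comp.1 h
    filter_upwards [hb hx, ha hm] with k hx hm
    exact mem_toCode_comp.2 ⟨x, hx, hm⟩
  | prec a b ha hb =>
    intro n m
    change m ∈ precVal _ _ _ _ → ∀ᶠ k in atTop, m ∈ precVal _ _ _ _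
    induction n.unpair.2 generalizing m with
    | zero => exact ha
    | succ k ih =>
      intro h
      obtain ⟨i, hi, hm⟩ := mem_precVal_succ.1 h
      filter_upwards [ih hi, hb hm] with k hi hm
      exact mem_precVal_succ.2 ⟨i, hi, hm⟩
  | rfind a ha =>
    intro n m h
    obtain ⟨h0, hk⟩ := mem_eval_rfind.1 h
    have hev : ∀ᶠ s in atTop, ∀ k ∈ Set.Iio m,
        ∃ v ∈ (finCode (initSeg q s) a).eval (Nat.pair n k), v ≠ 0 := by
      refine (Set.finite_Iio m).eventually_all.2 fun k hkm => ?_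
      obtain ⟨v, hv, hv0⟩ := hk k hkm
      exact (ha hv).mono fun s hs => ⟨v, hs, hv0⟩
    filter_upwards [ha h0, hev] with s h0 hs
    exact mem_toCode_rfind.2 ⟨h0, hs⟩
  | _ => exact fun h => .of_forall fun _ => h

/-- Run the `e`-th program with finite oracle `σ` for `s` steps. -/
noncomputable def stepEval (σ : List ℕ) (e s n : ℕ) : Option ℕ :=
  (finCode σ (ofNat e)).evaln s n

theorem primrec_stepEval : Primrec fun t : (List ℕ × ℕ) × ℕ × ℕ =>
    stepEval t.1.1 t.1.2 t.2.1 t.2.2 := by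
  open Primrec in
  have h1 : Primrec fun t : (List ℕ × ℕ) × ℕ × ℕ => finCode t.1.1 (ofNat t.1.2) :=
    primrec_toCode_ofNat.comp (Nat.Partrec.Code.primrec₂_curry.comp (const _)
      (Primrec.encode.comp (fst.comp fst))) (snd.comp fst)
  exact Nat.Partrec.Code.primrec_evaln.comp
    (((fst.comp snd).pair h1).pair (snd.comp snd))

theorem mem_eval_of_stepEval {σ : List ℕ} {q : Baire} {e s n m : ℕ} (hσ : Agrees σ q)
    (h : stepEval σ e s n = some m) : m ∈ (ofNat e).eval q n :=
  mem_eval_of_mem_finCode hσ _ (Nat.Partrec.Code.evaln_sound h)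

open Filter in
theorem eventually_exists_stepEval {q : Baire} {e n m : ℕ} (h : m ∈ (ofNat e).eval q n) :
    ∀ᶠ k in atTop, ∃ s, stepEval (initSeg q k) e s n = some m :=
  (eventually_mem_finCode _ h).mono fun _ hk => Nat.Partrec.Code.evaln_complete.1 hk

theorem agrees_initSeg (q : Baire) (k : ℕ) : Agrees (initSeg q k) q := by
  intro i a h
  simp only [initSeg, List.getElem?_map, Option.map_eq_some_iff, List.getElem?_eq_some_iff] at h
  obtain ⟨j, ⟨_, hj⟩, rfl⟩ := h
  rw [← hj]; simp

/-- Unbounded search: if every success of `o q n` yields the value `y`, then `y` can be found. -/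
theorem exists_search {o : Baire → ℕ → ℕ → Option ℕ}
    (ho : UniformlyComputable fun q t => Encodable.encode (o q t.unpair.1 t.unpair.2)) :
    ∃ c : OracleCode, ∀ q n m, (∀ t m', o q n t = some m' → m' = m) →
      (∃ t, o q n t = some m) → m ∈ c.eval q n := by
  -- `none` is encoded by 0 and `some m` by `m + 1`. So `1 - v` vanishes exactly at a success, where
  -- the search stops, and the predecessor then recovers the value.
  obtain ⟨d, hd⟩ := UniformlyComputable.comp_primrec
    (h := fun v => 1 - v) (Primrec.nat_sub.comp (Primrec.const 1) Primrec.id) ho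
  obtain ⟨d', hd'⟩ := UniformlyComputable.comp_primrec (h := Nat.pred) Primrec.pred ho
  obtain ⟨i, hi⟩ := UniformlyComputable.id
  refine ⟨.comp d' (.pair i (.rfind d)), fun q n m huniq hex => ?_⟩
  have hv : ∀ t, 1 - Encodable.encode (o q n t) ∈ d.eval q (Nat.pair n t) := fun t => by
    rw [hd]; simp
  classical
  have hfind := Nat.find_spec (p := fun t => (o q n t).isSome) (hex.imp fun t h => by simp [h])
  have hmin := fun k => Nat.find_min (p := fun t => (o q n t).isSome)
    (hex.imp fun t h => by simp [h]) (m := k)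
  set t := Nat.find (p := fun t => (o q n t).isSome) (hex.imp fun t h => by simp [h])
  obtain ⟨m', hm'⟩ := Option.isSome_iff_exists.1 hfind
  obtain rfl := huniq t m' hm'
  refine mem_eval_comp.2 ⟨Nat.pair n t, mem_eval_pair.2 ⟨n, by rw [hi]; exact Part.mem_some _, t,
    mem_eval_rfind.2 ⟨?_, fun k hk => ?_⟩, rfl⟩, ?_⟩
  · have := hv t
    simpa [hm'] using this
  · refine ⟨_, hv k, ?_⟩
    have := hmin k hk
    rw [Option.not_isSome_iff_eq_none.1 this]
    simp
  · rw [hd']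
    simp [hm']

/-! ### Composition, pairing and universality of Turing functionals. -/

theorem mem_Phi {e : ℕ} {x y : Baire} : y ∈ Phi e x ↔ ∀ n, y n ∈ (ofNat e).eval x n := by
  constructor
  · rintro ⟨h, rfl⟩ n
    exact Part.get_mem _
  · intro h
    exact ⟨fun n => (h n).fst, funext fun n => Part.get_eq_of_mem (h n) _⟩

theorem Phi_unique {e : ℕ} {x y z : Baire} (hy : y ∈ Phi e x) (hz : z ∈ Phi e x) : y = z :=
  Part.mem_unique hy hz

theorem exists_Phi_of_uniformlyComputable {F : Baire → Baire} (hF : UniformlyComputable F) :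
    ∃ e, ∀ x, F x ∈ Phi e x := by
  obtain ⟨c, hc⟩ := hF
  obtain ⟨e, rfl⟩ := exists_ofNat c
  exact ⟨e, fun x => mem_Phi.2 fun n => by rw [hc]; exact Part.mem_some _⟩

theorem exists_Phi_comp (e d : ℕ) : ∃ k, ∀ {x y z}, y ∈ Phi d x → z ∈ Phi e y → z ∈ Phi k x := by
  obtain ⟨k, hk⟩ := exists_ofNat (subst (ofNat d) (ofNat e))
  refine ⟨k, fun {x y z} hy hz => mem_Phi.2 fun n => ?_⟩
  rw [hk, eval_subst fun n => Part.eq_some_iff.2 (mem_Phi.1 hy n)]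
  exact mem_Phi.1 hz n

theorem exists_Phi_join (e d : ℕ) :
    ∃ k, ∀ {x y z}, y ∈ Phi e x → z ∈ Phi d x → join y z ∈ Phi k x := by
  obtain ⟨half, hhalf⟩ := UniformlyComputable.of_primrec (Primrec.nat_div.comp .id (.const 2))
  obtain ⟨sel, hsel⟩ := UniformlyComputable.of_primrec (g := fun m =>
    if m.unpair.1 % 2 = 0 then m.unpair.2.unpair.1 else m.unpair.2.unpair.2)
    (Primrec.ite (Primrec.eq.comp (Primrec.nat_mod.comp (Primrec.fst.comp .unpair) (.const 2))
      (.const 0)) (Primrec.fst.comp (Primrec.unpair.comp (Primrec.snd.comp .unpair)))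
      (Primrec.snd.comp (Primrec.unpair.comp (Primrec.snd.comp .unpair))))
  obtain ⟨i, hi⟩ := UniformlyComputable.id
  obtain ⟨k, hk⟩ := exists_ofNat (.comp sel (.pair i (.pair (.comp (ofNat e) half)
    (.comp (ofNat d) half))))
  refine ⟨k, fun {x y z} hy hz => mem_Phi.2 fun n => ?_⟩
  rw [hk]
  have hh : n / 2 ∈ half.eval x n := by rw [hhalf]; exact Part.mem_some _
  refine mem_eval_comp.2 ⟨Nat.pair n (Nat.pair (y (n / 2)) (z (n / 2))),
    mem_eval_pair.2 ⟨n, by rw [hi]; exact Part.mem_some _, _, mem_eval_pair.2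
      ⟨_, mem_eval_comp.2 ⟨_, hh, mem_Phi.1 hy _⟩, _, mem_eval_comp.2 ⟨_, hh, mem_Phi.1 hz _⟩, rfl⟩,
      rfl⟩, ?_⟩
  rw [hsel]
  simp [join]

/-- The sequence `q` without its first entry. -/
def tail (q : Baire) : Baire := fun n => q (n + 1)

/-- The entries of `q` in even places. -/
def evens (q : Baire) : Baire := fun n => q (2 * n)

/-- The entries of `q` in odd places. -/
def odds (q : Baire) : Baire := fun n => q (2 * n + 1)

@[simp] theorem tail_cons (e : ℕ) (q : Baire) : tail (cons e q) = q := rfl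

@[simp] theorem cons_zero (e : ℕ) (q : Baire) : cons e q 0 = e := rfl

@[simp] theorem evens_join (p q : Baire) : evens (join p q) = p := by
  funext n; simp [evens, join]

@[simp] theorem odds_join (p q : Baire) : odds (join p q) = q := by
  funext n
  have h : (2 * n + 1) % 2 = 1 := by omega
  have h' : (2 * n + 1) / 2 = n := by omega
  simp [odds, join, h, h']

theorem exists_Phi_id : ∃ e, ∀ x, x ∈ Phi e x :=
  exists_Phi_of_uniformlyComputable (F := fun x => x) (.oracle .id)

theorem exists_Phi_tail : ∃ e, ∀ x, tail x ∈ Phi e x :=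
  exists_Phi_of_uniformlyComputable (.oracle (.of_primrec .succ))

theorem exists_Phi_evens : ∃ e, ∀ p q, p ∈ Phi e (join p q) := by
  obtain ⟨e, he⟩ := exists_Phi_of_uniformlyComputable (F := evens)
    (.oracle (.of_primrec (Primrec.nat_mul.comp (.const 2) .id)))
  exact ⟨e, fun p q => by simpa using he (join p q)⟩

theorem exists_Phi_odds : ∃ e, ∀ p q, q ∈ Phi e (join p q) := by
  obtain ⟨e, he⟩ := exists_Phi_of_uniformlyComputable (F := odds)
    (.oracle (.of_primrec (Primrec.succ.comp (Primrec.nat_mul.comp (.const 2) .id))))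
  exact ⟨e, fun p q => by simpa using he (join p q)⟩

theorem exists_Phi_const (k : ℕ) : ∃ e, ∀ x, (fun _ => k) ∈ Phi e x :=
  exists_Phi_of_uniformlyComputable (.const k)

theorem exists_Phi_cons_of_primrec {g : ℕ → ℕ} (hg : Primrec g) :
    ∃ e, ∀ x, cons (g (x 0)) x ∈ Phi e x := by
  have h : UniformlyComputable fun q n => if n = 0 then g (q 0) else q n.pred := by
    have h2 : Primrec₂ fun (a : ℕ) (b : ℕ) => if a = 0 then b.unpair.1 else b.unpair.2 :=
      Primrec.ite (Primrec.eq.comp .fst (.const 0)) (Primrec.fst.comp (Primrec.unpair.comp .snd))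
        (Primrec.snd.comp (Primrec.unpair.comp .snd))
    have := UniformlyComputable.comp₂ h2 .id (UniformlyComputable.pair
      (.comp_primrec hg (.oracle (.const 0))) (.oracle (.of_primrec .pred)))
    simpa using this
  obtain ⟨e, he⟩ := exists_Phi_of_uniformlyComputable h
  refine ⟨e, fun x => ?_⟩
  convert he x using 1
  funext n
  cases n <;> rfl

theorem exists_Phi_cons (n : ℕ) : ∃ e, ∀ x, cons n x ∈ Phi e x :=
  exists_Phi_cons_of_primrec (.const n)

/-- A universal functional. -/
theorem exists_Phi_universal : ∃ u, ∀ {e x y}, y ∈ Phi e x → y ∈ Phi u (cons e x) := by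
  have ho : UniformlyComputable fun q t => Encodable.encode
      (stepEval (initSeg (tail q) t.unpair.2.unpair.1) (q 0) t.unpair.2.unpair.2 t.unpair.1) := by
    have hp : Primrec₂ fun a b : ℕ => Encodable.encode (stepEval
        (Denumerable.ofNat (List ℕ) a).tail b.unpair.1 b.unpair.2.unpair.2.unpair.2
          b.unpair.2.unpair.1) := by
      open Primrec in
      have hb : Primrec fun p : ℕ × ℕ => p.2.unpair := unpair.comp snd
      have hc : Primrec fun p : ℕ × ℕ => p.2.unpair.2.unpair := unpair.comp (snd.comp hb)
      exact Primrec.encode.comp (primrec_stepEval.comp (Primrec.pair (Primrec.pair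
        (list_tail.comp ((Primrec.ofNat _).comp fst)) (fst.comp hb))
        (Primrec.pair (snd.comp (unpair.comp (snd.comp hc))) (fst.comp hc))))
    -- A segment of `tail q` of length `k` is the tail of a segment of `q` of length `k + 1`.
    have := UniformlyComputable.comp₂ hp
      (UniformlyComputable.comp uniformlyComputable_initSeg (UniformlyComputable.of_primrec
        (Primrec.succ.comp (Primrec.fst.comp (Primrec.unpair.comp (Primrec.snd.comp .unpair))))))
      ((UniformlyComputable.const 0).oracle.pair .id)
    refine (congrArg UniformlyComputable ?_).mp this
    funext q t
    have hs : ∀ k, (initSeg q (k + 1)).tail = initSeg (tail q) k := by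
      intro k
      simp [initSeg, List.range_succ_eq_map, tail, Function.comp_def]
    simp [hs]
  obtain ⟨c, hc⟩ := exists_search (o := fun q n t =>
    stepEval (initSeg (tail q) t.unpair.1) (q 0) t.unpair.2 n) ho
  obtain ⟨u, rfl⟩ := exists_ofNat c
  refine ⟨u, fun {e x y} h => mem_Phi.2 fun n => hc _ n (y n) (fun t m' ht => ?_) ?_⟩
  · exact Part.mem_unique (mem_eval_of_stepEval (agrees_initSeg _ _) ht) (mem_Phi.1 h n)
  · obtain ⟨k, s, hks⟩ := (eventually_exists_stepEval (mem_Phi.1 h n)).exists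
    exact ⟨Nat.pair k s, by simpa using hks⟩

/-- Case distinction on the first entry of the input. -/
theorem exists_Phi_ite (k a b : ℕ) : ∃ e, ∀ {x y},
    (x 0 = k → y ∈ Phi a x) → (x 0 ≠ k → y ∈ Phi b x) → y ∈ Phi e x := by
  obtain ⟨u, hu⟩ := exists_Phi_universal
  -- The index selected by the first entry is prepended for the universal functional to run.
  obtain ⟨d, hd⟩ := exists_Phi_cons_of_primrec (g := fun m => if m = k then a else b)
    (Primrec.ite (Primrec.eq.comp .id (.const k)) (.const a) (.const b))
  obtain ⟨e, he⟩ := exists_Phi_comp u d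
  refine ⟨e, fun {x y} h1 h2 => he (hd x) (hu ?_)⟩
  split_ifs with h
  exacts [h1 h, h2 h]

/-! ### Turing reducibility and countability of lower cones. -/

theorem turingLE_iff {q p : Baire} : TuringLE q p ↔ ∃ e, q ∈ Phi e p := by
  constructor
  · intro h
    have key : ∀ f : ℕ →. ℕ, Nat.RecursiveIn {(p : ℕ →. ℕ)} f → ∃ c : OracleCode, c.eval p = f := by
      intro f hf
      induction hf with
      | zero => exact ⟨.zero, rfl⟩
      | succ => exact ⟨.succ, rfl⟩
      | left => exact ⟨.left, rfl⟩
      | right => exact ⟨.right, rfl⟩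
      | oracle g hg => exact ⟨.oracle, by rw [Set.mem_singleton_iff.1 hg]; rfl⟩
      | pair _ _ hc hd =>
        obtain ⟨c, rfl⟩ := hc
        obtain ⟨d, rfl⟩ := hd
        exact ⟨.pair c d, rfl⟩
      | comp _ _ hc hd =>
        obtain ⟨c, rfl⟩ := hc
        obtain ⟨d, rfl⟩ := hd
        exact ⟨.comp c d, rfl⟩
      | prec _ _ hc hd =>
        obtain ⟨c, rfl⟩ := hc
        obtain ⟨d, rfl⟩ := hd
        exact ⟨.prec c d, rfl⟩
      | rfind _ hc =>
        obtain ⟨c, rfl⟩ := hc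
        exact ⟨.rfind c, rfl⟩
    obtain ⟨c, hc⟩ := key _ (RecursiveIn.iff_nat.1 h)
    obtain ⟨e, rfl⟩ := exists_ofNat c
    exact ⟨e, mem_Phi.2 fun n => by rw [hc]; exact Part.mem_some _⟩
  · rintro ⟨e, he⟩
    have key : ∀ c : OracleCode, Nat.RecursiveIn {(p : ℕ →. ℕ)} (c.eval p) := by
      intro c
      induction c with
      | zero => exact .zero
      | succ => exact .succ
      | left => exact .left
      | right => exact .right
      | oracle => exact .oracle _ rfl
      | pair _ _ hc hd => exact .pair hc hd
      | comp _ _ hc hd => exact .comp hc hd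
      | prec _ _ hc hd => exact .prec hc hd
      | rfind _ hc => exact .rfind hc
    refine RecursiveIn.iff_nat.2 ?_
    have : (ofNat e).eval p = (q : ℕ →. ℕ) :=
      funext fun n => Part.eq_some_iff.2 (mem_Phi.1 he n)
    exact this ▸ key _

theorem TuringLE.trans {p q r : Baire} (h₁ : TuringLE p q) (h₂ : TuringLE q r) : TuringLE p r :=
  TuringReducible.trans h₁ h₂

theorem countable_setOf_turingLE (p : Baire) : {q | TuringLE q p}.Countable := by
  have : {q | TuringLE q p} ⊆ ⋃ e, {q | q ∈ Phi e p} := fun q hq => by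
    simpa using turingLE_iff.1 hq
  refine (Set.countable_iUnion fun e => Set.Subsingleton.countable ?_).mono this
  exact fun x hx y hy => Phi_unique hx hy

/-- The range of an injective function contains a sequence that is not computable from `p`. -/
theorem exists_not_turingLE (p : Baire) {F : Baire → Baire} (hF : Function.Injective F) :
    ∃ r, ¬ TuringLE (F r) p := by
  by_contra! h
  have hc := (countable_setOf_turingLE p).preimage hF
  have huniv : F ⁻¹' {q | TuringLE q p} = Set.univ := Set.eq_univ_of_forall h
  rw [huniv, Set.countable_univ_iff] at hc
  obtain ⟨f, hf⟩ := exists_surjective_nat Baire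
  obtain ⟨n, hn⟩ := hf fun k => f k k + 1
  exact Nat.succ_ne_self _ (congrFun hn n).symm

/-! ### Weihrauch reductions in terms of indices. -/

/-- The functionals `Φ_e` and `Φ_i` solve the instance `p` with solution set `S` by means of
one call to `g`. -/
def SolvesAt (e i : ℕ) (S : Set Baire) (g : Problem) (p : Baire) : Prop :=
  ∃ x ∈ Phi e p, x ∈ g.dom ∧ ∀ q ∈ g x, ∃ y ∈ Phi i (join p q), y ∈ S

/-- The functionals `Φ_e` and `Φ_i` witness that `f` is Weihrauch reducible to `g`. -/
def ReducesVia (e i : ℕ) (f g : Problem) : Prop := ∀ p ∈ f.dom, SolvesAt e i (f p) g p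

theorem wle_iff {f g : Problem} : WLE f g ↔ ∃ e i, ReducesVia e i f g := by
  constructor
  · rintro ⟨F, G, ⟨e, rfl⟩, ⟨i, hi⟩, h⟩
    refine ⟨e, i, fun p hp => ?_⟩
    simpa only [hi, SolvesAt] using h p hp
  · rintro ⟨e, i, h⟩
    exact ⟨Phi e, fun pq => Phi i (join pq.1 pq.2), ⟨e, rfl⟩, ⟨i, fun _ _ => rfl⟩, h⟩

theorem WLE.trans {f g h : Problem} (h₁ : WLE f g) (h₂ : WLE g h) : WLE f h := by
  obtain ⟨e, i, hfg⟩ := wle_iff.1 h₁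
  obtain ⟨d, j, hgh⟩ := wle_iff.1 h₂
  obtain ⟨l, hl⟩ := exists_Phi_evens
  obtain ⟨r, hr⟩ := exists_Phi_odds
  obtain ⟨k, hk⟩ := exists_Phi_comp d e
  obtain ⟨k₁, hk₁⟩ := exists_Phi_comp e l
  obtain ⟨k₂, hk₂⟩ := exists_Phi_join k₁ r
  obtain ⟨k₃, hk₃⟩ := exists_Phi_comp j k₂
  obtain ⟨k₄, hk₄⟩ := exists_Phi_join l k₃
  obtain ⟨k₅, hk₅⟩ := exists_Phi_comp i k₄
  refine wle_iff.2 ⟨k, k₅, fun p hp => ?_⟩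
  obtain ⟨x, hx, hxd, hxs⟩ := hfg p hp
  obtain ⟨z, hz, hzd, hzs⟩ := hgh x hxd
  refine ⟨z, hk hx hz, hzd, fun q hq => ?_⟩
  obtain ⟨y, hy, hyx⟩ := hzs q hq
  obtain ⟨w, hw, hwp⟩ := hxs y hyx
  exact ⟨w, hk₅ (hk₄ (hl p q) (hk₃ (hk₂ (hk₁ (hl p q) hx) (hr p q)) hy)) hw, hwp⟩

/-- A reduction that passes every solution on unchanged. -/
theorem WLE.of_Phi {f g : Problem} (e : ℕ)
    (h : ∀ p ∈ f.dom, ∃ x ∈ Phi e p, x ∈ g.dom ∧ g x ⊆ f p) : WLE f g := by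
  obtain ⟨r, hr⟩ := exists_Phi_odds
  refine wle_iff.2 ⟨e, r, fun p hp => ?_⟩
  obtain ⟨x, hx, hxd, hs⟩ := h p hp
  exact ⟨x, hx, hxd, fun q hq => ⟨q, hr p q, hs hq⟩⟩

theorem WLE.of_subset {f g : Problem} (h : ∀ p ∈ f.dom, p ∈ g.dom ∧ g p ⊆ f p) : WLE f g := by
  obtain ⟨e, he⟩ := exists_Phi_id
  exact .of_Phi e fun p hp => ⟨p, he p, h p hp⟩

theorem WLE.refl (f : Problem) : WLE f f := .of_subset fun _ hp => ⟨hp, subset_rfl⟩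

theorem WEquiv.symm {f g : Problem} (h : WEquiv f g) : WEquiv g f := ⟨h.2, h.1⟩

theorem WEquiv.trans {f g h : Problem} (h₁ : WEquiv f g) (h₂ : WEquiv g h) : WEquiv f h :=
  ⟨h₁.1.trans h₂.1, h₂.2.trans h₁.2⟩

theorem mem_dom_idOn {A : Set Baire} {p : Baire} : p ∈ (idOn A).dom ↔ p ∈ A :=
  ⟨fun ⟨_, h⟩ => h.1, fun h => ⟨p, h, rfl⟩⟩

/-- A reduction of a restricted identity is a computable map between the domains. -/
theorem idOn_wle_iff {A : Set Baire} {g : Problem} :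
    WLE (idOn A) g ↔ ∃ e, ∀ p ∈ A, ∃ x ∈ Phi e p, x ∈ g.dom := by
  constructor
  · intro h
    obtain ⟨e, i, h⟩ := wle_iff.1 h
    refine ⟨e, fun p hp => ?_⟩
    obtain ⟨x, hx, hxd, -⟩ := h p (mem_dom_idOn.2 hp)
    exact ⟨x, hx, hxd⟩
  · rintro ⟨e, h⟩
    obtain ⟨l, hl⟩ := exists_Phi_evens
    refine wle_iff.2 ⟨e, l, fun p hp => ?_⟩
    obtain ⟨x, hx, hxd⟩ := h p (mem_dom_idOn.1 hp)
    exact ⟨x, hx, hxd, fun q _ => ⟨p, hl p q, mem_dom_idOn.1 hp, rfl⟩⟩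

/-! ### Restrictions by the first entry, and generic sets. -/

/-- The restriction of `g` to the inputs whose first entry lies in `A`. -/
def restrict (g : Problem) (A : Set ℕ) : Problem := fun x => {y | x 0 ∈ A ∧ y ∈ g x}

theorem mem_dom_restrict {g : Problem} {A : Set ℕ} {x : Baire} :
    x ∈ (restrict g A).dom ↔ x 0 ∈ A ∧ x ∈ g.dom :=
  ⟨fun ⟨y, h, hy⟩ => ⟨h, y, hy⟩, fun ⟨h, y, hy⟩ => ⟨y, h, hy⟩⟩

theorem restrict_apply {g : Problem} {A : Set ℕ} {x : Baire} (h : x 0 ∈ A) :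
    restrict g A x = g x := Set.ext fun _ => and_iff_right h

theorem restrict_wle (g : Problem) (A : Set ℕ) : WLE (restrict g A) g :=
  .of_subset fun _ hp => ⟨(mem_dom_restrict.1 hp).2, (restrict_apply (mem_dom_restrict.1 hp).1).ge⟩

/-- The first entry of `p` is also the first entry of `join p q`, so both functionals of the
reduction can make the same case distinction. -/
theorem WLE.restrict_insert {g h : Problem} {A : Set ℕ} {n : ℕ} (hA : WLE (restrict g A) h)
    (hn : WLE (restrict g {n}) h) : WLE (restrict g (insert n A)) h := by
  obtain ⟨e, i, hA⟩ := wle_iff.1 hA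
  obtain ⟨d, j, hn⟩ := wle_iff.1 hn
  obtain ⟨k, hk⟩ := exists_Phi_ite n d e
  obtain ⟨l, hl⟩ := exists_Phi_ite n j i
  refine wle_iff.2 ⟨k, l, fun p hp => ?_⟩
  obtain ⟨hpA, hpg⟩ := mem_dom_restrict.1 hp
  have h0 : ∀ q, join p q 0 = p 0 := fun q => rfl
  by_cases hpn : p 0 = n
  · obtain ⟨x, hx, hxd, hs⟩ := hn p (mem_dom_restrict.2 ⟨hpn, hpg⟩)
    rw [restrict_apply (by simpa using hpn)] at hs
    rw [restrict_apply hpA]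
    refine ⟨x, hk (fun _ => hx) (absurd hpn), hxd, fun q hq => ?_⟩
    obtain ⟨y, hy, hyp⟩ := hs q hq
    exact ⟨y, hl (fun _ => hy) (absurd hpn), hyp⟩
  · have hpA' := hpA.resolve_left hpn
    obtain ⟨x, hx, hxd, hs⟩ := hA p (mem_dom_restrict.2 ⟨hpA', hpg⟩)
    rw [restrict_apply hpA'] at hs
    rw [restrict_apply hpA]
    refine ⟨x, hk (fun h => absurd h hpn) (fun _ => hx), hxd, fun q hq => ?_⟩
    obtain ⟨y, hy, hyp⟩ := hs q hq
    exact ⟨y, hl (fun h => absurd h hpn) (fun _ => hy), hyp⟩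

theorem WLE.restrict_union_finset {g h : Problem} {A : Set ℕ} (hA : WLE (restrict g A) h)
    (hn : ∀ n, WLE (restrict g {n}) h) (S : Finset ℕ) : WLE (restrict g (A ∪ S)) h := by
  classical
  induction S using Finset.induction with
  | empty => simpa using hA
  | insert n S _ ih =>
    rw [Finset.coe_insert, Set.union_insert]
    exact ih.restrict_insert (hn n)

/-- Finite information on a set of natural numbers: elements of the set and of its complement. -/
abbrev Cond : Type := {c : Finset ℕ × Finset ℕ // Disjoint c.1 c.2}

/-- The set `A` obeys the condition `c`. -/
def Cond.Holds (c : Cond) (A : Set ℕ) : Prop := (c.1.1 : Set ℕ) ⊆ A ∧ Disjoint A c.1.2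

/-- The Rasiowa-Sikorski lemma for subsets of `ℕ`. -/
theorem exists_generic {ι : Type*} [Encodable ι] (P : ι → Set ℕ → Prop)
    (hP : ∀ i (c : Cond), ∃ d : Cond, c ≤ d ∧ ∀ A, d.Holds A → P i A) : ∃ A, ∀ i, P i A := by
  let D (i : ι) : Order.Cofinal Cond := ⟨{d | ∀ A, d.Holds A → P i A}, fun c => by
    obtain ⟨d, hcd, hd⟩ := hP i c
    exact ⟨d, hd, hcd⟩⟩
  let I := Order.idealOfCofinals (⟨(∅, ∅), disjoint_bot_left⟩ : Cond) D
  refine ⟨{n | ∃ c ∈ I, n ∈ c.1.1}, fun i => ?_⟩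
  obtain ⟨c, hcD, hcI⟩ := Order.cofinal_meets_idealOfCofinals
    (⟨(∅, ∅), disjoint_bot_left⟩ : Cond) D i
  refine hcD _ ⟨fun n hn => ⟨c, hcI, hn⟩, ?_⟩
  rw [Set.disjoint_left]
  rintro n ⟨d, hd, hnd⟩ hnc
  -- A common extension of the two conditions would have `n` on both sides.
  obtain ⟨b, -, hdb, hcb⟩ := I.directed d hd c hcI
  exact Finset.disjoint_left.1 b.2 (hdb.1 hnd) (hcb.2 hnc)

/-- If `g ≰ h`, but each restriction of `g` to inputs with fixed first entry is reducible to `h`,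
then some restriction of `g` lies strictly below `g` and not below `h`. -/
theorem exists_restrict_not_wle {g h : Problem} (hgh : ¬ WLE g h)
    (hn : ∀ n, WLE (restrict g {n}) h) :
    ∃ A, ¬ WLE (restrict g A) h ∧ ¬ WLE g (restrict g A) := by
  suffices H : ∃ A, ∀ t : Bool × ℕ × ℕ, ¬ (if t.1 then ReducesVia t.2.1 t.2.2 (restrict g A) h
      else ReducesVia t.2.1 t.2.2 g (restrict g A)) by
    obtain ⟨A, hA⟩ := H
    refine ⟨A, fun h => ?_, fun h => ?_⟩
    · obtain ⟨e, i, h⟩ := wle_iff.1 h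
      exact hA (true, e, i) h
    · obtain ⟨e, i, h⟩ := wle_iff.1 h
      exact hA (false, e, i) (by simpa using h)
  refine exists_generic _ ?_
  rintro ⟨b, e, i⟩ ⟨⟨I, O⟩, hdisj⟩
  classical
  cases b with
  | true =>
    -- Otherwise the finitely many first entries in `O` could be added back, and all of `g` would
    -- reduce to `h`. A failing instance outside `O` is then committed to `A`.
    have hO : ¬ ReducesVia e i (restrict g (O : Set ℕ)ᶜ) h := by
      intro hr
      have := (wle_iff.2 ⟨e, i, hr⟩).restrict_union_finset hn O
      rw [Set.compl_union_self] at this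
      exact hgh (.trans (.of_subset fun p hp => ⟨mem_dom_restrict.2 ⟨Set.mem_univ _, hp⟩,
        (restrict_apply (Set.mem_univ _)).le⟩) this)
    simp only [ReducesVia, not_forall] at hO
    obtain ⟨p, hp, hps⟩ := hO
    obtain ⟨hpO, hpg⟩ := mem_dom_restrict.1 hp
    have hpO' : p 0 ∉ O := by simpa using hpO
    refine ⟨⟨(insert (p 0) I, O), ?_⟩, ⟨Finset.subset_insert _ _, subset_rfl⟩, ?_⟩
    · exact Finset.disjoint_insert_left.2 ⟨hpO', hdisj⟩
    · intro A hA hr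
      have hpA : p 0 ∈ A := hA.1 (by simp)
      have := hr p (mem_dom_restrict.2 ⟨hpA, hpg⟩)
      rw [restrict_apply hpA] at this
      rw [restrict_apply hpO] at hps
      exact hps this
  | false =>
    -- If some query leaves `I`, its first entry is excluded from `A`. If none does, `g` would
    -- reduce to its restriction to the finite set `I`, hence to `h`.
    by_cases hex : ∃ x ∈ g.dom, ∃ z ∈ Phi e x, z 0 ∉ I
    · obtain ⟨x, hx, z, hz, hzI⟩ := hex
      refine ⟨⟨(I, insert (z 0) O), ?_⟩, ⟨subset_rfl, Finset.subset_insert _ _⟩, ?_⟩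
      · exact Finset.disjoint_insert_right.2 ⟨hzI, hdisj⟩
      · intro A hA hr
        obtain ⟨w, hw, hwd, -⟩ := (by simpa using hr : ReducesVia e i g (restrict g A)) x hx
        obtain rfl := Phi_unique hw hz
        exact Set.disjoint_left.1 hA.2 (mem_dom_restrict.1 hwd).1 (by simp)
    · push Not at hex
      refine ⟨⟨(I, O), hdisj⟩, le_rfl, fun A _ hr => hgh ?_⟩
      replace hr : ReducesVia e i g (restrict g A) := by simpa using hr
      have h1 : WLE g (restrict g (I : Set ℕ)) := by
        refine wle_iff.2 ⟨e, i, fun p hp => ?_⟩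
        obtain ⟨x, hx, hxd, hs⟩ := hr p hp
        have hxI := hex p hp x hx
        obtain ⟨hxA, hxg⟩ := mem_dom_restrict.1 hxd
        refine ⟨x, hx, mem_dom_restrict.2 ⟨hxI, hxg⟩, ?_⟩
        rw [restrict_apply hxA] at hs
        rwa [restrict_apply (by simpa using hxI)]
      have h2 : WLE (restrict g (∅ : Set ℕ)) h :=
        .of_subset fun p hp => absurd (mem_dom_restrict.1 hp).1 (Set.notMem_empty _)
      have h3 := h2.restrict_union_finset hn I
      rw [Set.empty_union] at h3
      exact h1.trans h3

/-! ### Strong minimal covers are identities on points. -/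

theorem zero_seq_ne_one_seq : (fun _ => 0 : Baire) ≠ fun _ => 1 := fun h =>
  zero_ne_one (congrFun h 0)

/-- A strong minimal cover of `h` is equivalent to a restriction of the identity to a point. -/
theorem IsStrongMinimalCover.exists_wequiv_idOn {f h : Problem} (hf : IsStrongMinimalCover f h) :
    ∃ p, WEquiv f (idOn {p}) := by
  obtain ⟨⟨hhf, hfh⟩, hmin⟩ := hf
  have above : ∀ g, WLE g f → ¬ WLE g h → WLE f g := fun g hgf hgh =>
    by_contra fun hfg => hgh (hmin g ⟨hgf, hfg⟩)
  have hB : ∀ n : ℕ, ∃ (p : Baire) (B : Set Baire), p ∈ f.dom ∧ f p ⊆ B ∧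
      ((fun _ => 0) ∈ B ∨ (fun _ => 1) ∈ B) ∧
      ¬ SolvesAt n.unpair.1 n.unpair.2 B h (cons n p) := by
    intro n
    obtain ⟨c, hc⟩ := exists_Phi_cons n
    obtain ⟨l, hl⟩ := exists_Phi_evens
    obtain ⟨r, hr⟩ := exists_Phi_odds
    obtain ⟨e, he⟩ := exists_Phi_comp n.unpair.1 c
    obtain ⟨k₁, hk₁⟩ := exists_Phi_comp c l
    obtain ⟨k₂, hk₂⟩ := exists_Phi_join k₁ r
    obtain ⟨i, hi⟩ := exists_Phi_comp n.unpair.2 k₂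
    -- `e` and `i` simulate the pair coded by `n` on the input `n⌢p`; their failure as a reduction
    -- of `f` to `h` supplies `p`.
    have hnot : ¬ ReducesVia e i f h := fun hr => hfh (wle_iff.2 ⟨e, i, hr⟩)
    simp only [ReducesVia, not_forall] at hnot
    obtain ⟨p, hp, hps⟩ := hnot
    refine ⟨p, ?_⟩
    by_cases hx : ∃ x ∈ Phi n.unpair.1 (cons n p), x ∈ h.dom
    · obtain ⟨x, hx, hxd⟩ := hx
      have : ∃ q ∈ h x, ∀ y ∈ Phi n.unpair.2 (join (cons n p) q), y ∉ f p := by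
        by_contra! hcon
        refine hps ⟨x, he (hc p) hx, hxd, fun q hq => ?_⟩
        obtain ⟨y, hy, hyp⟩ := hcon q hq
        exact ⟨y, hi (hk₂ (hk₁ (hl p q) (hc p)) (hr p q)) hy, hyp⟩
      obtain ⟨q, hq, hqy⟩ := this
      -- Only the possible output on the bad answer `q` is removed. It is unique if it exists, so it
      -- cannot equal both constants.
      refine ⟨{y | y ∉ Phi n.unpair.2 (join (cons n p) q)}, hp,
        fun y hy hmem => hqy y hmem hy, ?_, ?_⟩
      · by_contra! hcon
        simp only [Set.mem_ofPred_eq, not_not] at hcon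
        exact zero_seq_ne_one_seq (Phi_unique hcon.1 hcon.2)
      · rintro ⟨x', hx', -, hs⟩
        obtain rfl := Phi_unique hx hx'
        obtain ⟨y, hy, hyn⟩ := hs q hq
        exact hyn hy
    · exact ⟨Set.univ, hp, Set.subset_univ _, .inl trivial,
        fun ⟨x, hx', hxd, _⟩ => hx ⟨x, hx', hxd⟩⟩
  choose p B hp hfB hconst hns using hB
  let g : Problem := fun x => {y | x = cons (x 0) (p (x 0)) ∧ y ∈ B (x 0)}
  have hdom : ∀ n, cons n (p n) ∈ g.dom := fun n => (hp n).imp fun y hy => ⟨rfl, hfB n hy⟩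
  have hgf : WLE g f := by
    obtain ⟨t, ht⟩ := exists_Phi_tail
    refine .of_Phi t fun x hx => ?_
    obtain ⟨y, hx, hy⟩ := hx
    refine ⟨tail x, ht x, ?_⟩
    have : tail x = p (x 0) := (congrArg tail hx).trans (tail_cons _ _)
    rw [this]
    exact ⟨hp _, fun y hy => ⟨hx, hfB _ hy⟩⟩
  have hgh : ¬ WLE g h := by
    intro hgh
    obtain ⟨e, i, hr⟩ := wle_iff.1 hgh
    refine hns (Nat.pair e i) ?_
    rw [Nat.unpair_pair]
    obtain ⟨x, hx, hxd, hs⟩ := hr _ (hdom (Nat.pair e i))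
    refine ⟨x, hx, hxd, fun q hq => ?_⟩
    obtain ⟨y, hy, hyg⟩ := hs q hq
    exact ⟨y, hy, hyg.2⟩
  have hfg := above g hgf hgh
  have hex : ∃ n, ¬ WLE (restrict g {n}) h := by
    by_contra! hall
    obtain ⟨A, hA, hgA⟩ := exists_restrict_not_wle hgh hall
    -- `g|A` is below `f` and not below `h`, hence above `f` and so above `g`.
    exact hgA (hgf.trans (above _ ((restrict_wle g A).trans hgf) hA))
  obtain ⟨n, hn⟩ := hex
  have hpt : ∀ x ∈ (restrict g {n}).dom, x = cons n (p n) ∧ restrict g {n} x = B n := by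
    intro x hx
    obtain ⟨hxn, y, hxe, -⟩ := mem_dom_restrict.1 hx
    obtain rfl : x 0 = n := hxn
    exact ⟨hxe, Set.ext fun y => ⟨fun hy => hy.2.2, fun hy => ⟨rfl, hxe, hy⟩⟩⟩
  have hrdom : cons n (p n) ∈ (restrict g {n}).dom := mem_dom_restrict.2 ⟨rfl, hdom n⟩
  refine ⟨cons n (p n), (above _ ((restrict_wle g _).trans hgf) hn).trans ?_,
    .trans ?_ ((restrict_wle g {n}).trans hgf)⟩
  · obtain ⟨e, he⟩ := exists_Phi_id
    -- The one remaining instance has a constant solution, so the answer of the oracle is not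
    -- needed.
    obtain ⟨k, hk⟩ : ∃ k, ∀ x, ∃ y ∈ Phi k x, y ∈ B n := by
      rcases hconst n with h | h
      · obtain ⟨k, hk⟩ := exists_Phi_const 0
        exact ⟨k, fun x => ⟨_, hk x, h⟩⟩
      · obtain ⟨k, hk⟩ := exists_Phi_const 1
        exact ⟨k, fun x => ⟨_, hk x, h⟩⟩
    refine wle_iff.2 ⟨e, k, fun x hx => ⟨x, he x, mem_dom_idOn.2 (hpt x hx).1, fun q _ => ?_⟩⟩
    rw [(hpt x hx).2]
    exact hk _
  · obtain ⟨e, he⟩ := exists_Phi_id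
    exact idOn_wle_iff.2 ⟨e, fun x hx => ⟨x, he x, Set.mem_singleton_iff.1 hx ▸ hrdom⟩⟩

/-- The identity on a point is a strong minimal cover of the identity on its Medvedev successor. -/
theorem isStrongMinimalCover_idOn (p : Baire) :
    IsStrongMinimalCover (idOn {p}) (idOn (medvedevSucc p)) := by
  refine ⟨⟨?_, ?_⟩, fun g hg => ?_⟩
  · obtain ⟨u, hu⟩ := exists_Phi_universal
    refine idOn_wle_iff.2 ⟨u, ?_⟩
    rintro _ ⟨e, q, rfl, hq, -⟩
    exact ⟨p, hu hq, mem_dom_idOn.2 rfl⟩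
  · intro h
    obtain ⟨d, hd⟩ := idOn_wle_iff.1 h
    obtain ⟨x, hx, hxd⟩ := hd p rfl
    obtain ⟨e, q, rfl, -, hqp⟩ := mem_dom_idOn.1 hxd
    obtain ⟨t, ht⟩ := exists_Phi_tail
    obtain ⟨k, hk⟩ := exists_Phi_comp t d
    exact hqp (turingLE_iff.2 ⟨k, hk hx (ht _)⟩)
  · obtain ⟨hgp, hpg⟩ := hg
    obtain ⟨e, i, hr⟩ := wle_iff.1 hgp
    -- An instance `x` computable from `p` would reduce `id|_{p}` to `g`. The oracle's only answer
    -- is `p`, which `x` itself computes.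
    have key : ∀ x ∈ g.dom, p ∈ Phi e x ∧ ¬ TuringLE x p ∧ ∃ y ∈ Phi i (join x p), y ∈ g x := by
      intro x hx
      obtain ⟨p', hp', hd, hs⟩ := hr x hx
      have hpp : p' = p := Set.mem_singleton_iff.1 (mem_dom_idOn.1 hd)
      subst hpp
      refine ⟨hp', fun hle => hpg ?_, hs p' ⟨rfl, rfl⟩⟩
      obtain ⟨k, hk⟩ := turingLE_iff.1 hle
      exact idOn_wle_iff.2 ⟨k, fun z hz => ⟨x, Set.mem_singleton_iff.1 hz ▸ hk, hx⟩⟩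
    obtain ⟨c, hc⟩ := exists_Phi_cons e
    obtain ⟨l, hl⟩ := exists_Phi_evens
    obtain ⟨k₁, hk₁⟩ := exists_Phi_comp e l
    obtain ⟨k₂, hk₂⟩ := exists_Phi_join l k₁
    obtain ⟨k₃, hk₃⟩ := exists_Phi_comp i k₂
    refine wle_iff.2 ⟨c, k₃, fun x hx => ?_⟩
    obtain ⟨hpx, hxp, y, hy, hyx⟩ := key x hx
    exact ⟨_, hc x, mem_dom_idOn.2 ⟨e, x, rfl, hpx, hxp⟩,
      fun q _ => ⟨y, hk₃ (hk₂ (hl x q) (hk₁ (hl x q) hpx)) hy, hyx⟩⟩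

theorem IsStrongMinimalCover.congr {f f' h h' : Problem} (hf : WEquiv f f') (hh : WEquiv h h')
    (H : IsStrongMinimalCover f' h') : IsStrongMinimalCover f h :=
  ⟨⟨hh.1.trans (H.1.1.trans hf.2), fun hc => H.1.2 (hf.2.trans (hc.trans hh.1))⟩,
    fun g hg => (H.2 g ⟨hg.1.trans hf.1, fun hc => hg.2 (hf.1.trans hc)⟩).trans hh.2⟩

/-- A problem is a strong minimal cover of at most one degree. -/
theorem IsStrongMinimalCover.wequiv_right {f h h' : Problem} (H : IsStrongMinimalCover f h)
    (H' : IsStrongMinimalCover f h') : WEquiv h h' :=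
  ⟨H'.2 h H.1, H.2 h' H'.1⟩

/-- Once `f` is identified with `id|_{p}`, the degree of `h` is forced: any two problems strongly
minimally covered by `f` lie below each other. -/
theorem isStrongMinimalCover_iff {f h : Problem} : IsStrongMinimalCover f h ↔
    ∃ p : Baire, WEquiv f (idOn {p}) ∧ WEquiv h (idOn (medvedevSucc p)) := by
  constructor
  · intro H
    obtain ⟨p, hp⟩ := H.exists_wequiv_idOn
    exact ⟨p, hp, H.wequiv_right ((isStrongMinimalCover_idOn p).congr hp ⟨.refl _, .refl _⟩)⟩
  · rintro ⟨p, hf, hh⟩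
    exact (isStrongMinimalCover_idOn p).congr hf hh

/-! ### The Medvedev successor determines the Turing degree of the point. -/

/-- The interleaving of the string `τ` with the string `σ`, in the length of `σ`. -/
def mix (τ σ : List ℕ) : List ℕ :=
  (List.range (2 * σ.length)).map fun i => if i % 2 = 0 then τ.getD (i / 2) 0 else σ.getD (i / 2) 0

theorem primrec_mix : Primrec₂ mix := by
  open Primrec in
  refine list_map (list_range.comp (nat_mul.comp (const 2) (list_length.comp snd))) ?_
  have hi : Primrec fun p : (List ℕ × List ℕ) × ℕ => p.2 / 2 := nat_div.comp snd (const 2)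
  exact ite (Primrec.eq.comp (nat_mod.comp snd (const 2)) (const 0))
    ((list_getD 0).comp (fst.comp fst) hi) ((list_getD 0).comp (snd.comp fst) hi)

/-- The string `σ` followed by the sequence `r`. -/
def append (σ : List ℕ) (r : Baire) : Baire := fun n =>
  if n < σ.length then σ.getD n 0 else r (n - σ.length)

theorem append_injective (σ : List ℕ) : Function.Injective (append σ) := by
  intro r s h
  funext n
  simpa [append] using congrFun h (n + σ.length)

theorem initSeg_getD {q : Baire} {k i : ℕ} (h : i < k) : (initSeg q k).getD i 0 = q i := by
  simp [initSeg, h]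

theorem mix_eq_initSeg_join {p r : Baire} {σ : List ℕ} (h : ∀ i < σ.length, σ.getD i 0 = r i) :
    mix (initSeg p σ.length) σ = initSeg (join p r) (2 * σ.length) := by
  refine List.map_congr_left fun i hi => ?_
  have hi2 : i / 2 < σ.length := by
    have := List.mem_range.1 hi
    omega
  rw [initSeg_getD hi2, h _ hi2, join]

/-- If a functional finds `x` from `p` and any sequence not computable from `p`, then `x` is
computable from `p`. -/
theorem turingLE_of_forall_join {p x : Baire} {e : ℕ}
    (h : ∀ r, ¬ TuringLE r p → x ∈ Phi e (join p r)) : TuringLE x p := by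
  let σ (t : ℕ) : List ℕ := Denumerable.ofNat (List ℕ) t.unpair.1
  have ho : UniformlyComputable fun q t => Encodable.encode
      (stepEval (mix (initSeg q (σ t.unpair.2).length) (σ t.unpair.2)) e
        t.unpair.2.unpair.2 t.unpair.1) := by
    open Primrec in
    have hσ : Primrec fun t : ℕ => σ t.unpair.2 :=
      (Primrec.ofNat _).comp (fst.comp (unpair.comp (snd.comp unpair)))
    have hp : Primrec₂ fun a t : ℕ => Encodable.encode (stepEval (mix
        (Denumerable.ofNat (List ℕ) a) (σ t.unpair.2)) e t.unpair.2.unpair.2 t.unpair.1) :=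
      Primrec.encode.comp (primrec_stepEval.comp (Primrec.pair (Primrec.pair
        (primrec_mix.comp ((Primrec.ofNat _).comp fst) (hσ.comp snd)) (const e))
        (Primrec.pair (snd.comp (unpair.comp (snd.comp (unpair.comp snd))))
          (fst.comp (unpair.comp snd)))))
    have := UniformlyComputable.comp₂ hp (uniformlyComputable_initSeg.comp
      (UniformlyComputable.of_primrec (list_length.comp hσ))) .id
    simpa using this
  obtain ⟨c, hc⟩ := exists_search (o := fun q n t =>
    stepEval (mix (initSeg q (σ t).length) (σ t)) e t.unpair.2 n) ho
  obtain ⟨k, rfl⟩ := exists_ofNat c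
  refine turingLE_iff.2 ⟨k, mem_Phi.2 fun n => hc p n (x n) (fun t m' ht => ?_) ?_⟩
  -- Soundness: the string found extends to some `r` not computable from `p`, where the functional
  -- outputs `x`.
  · obtain ⟨r, hr⟩ := exists_not_turingLE p (append_injective (σ t))
    rw [mix_eq_initSeg_join (r := append (σ t) r) fun i hi => by simp [append, hi]] at ht
    exact Part.mem_unique (mem_eval_of_stepEval (agrees_initSeg _ _) ht) (mem_Phi.1 (h _ hr) n)
  · obtain ⟨r, hr⟩ := exists_not_turingLE p Function.injective_id
    obtain ⟨N, hN⟩ := Filter.eventually_atTop.1 (eventually_exists_stepEval (mem_Phi.1 (h r hr) n))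
    -- A string of length `N` yields an oracle segment of length `2 * N`, since it is interleaved
    -- with `p`.
    obtain ⟨s, hs⟩ := hN (2 * N) (by omega)
    refine ⟨Nat.pair (Encodable.encode (initSeg r N)) s, ?_⟩
    have hlen : (initSeg r N).length = N := by simp [initSeg]
    have hmix := mix_eq_initSeg_join (p := p) (r := r) (σ := initSeg r N)
      fun i hi => initSeg_getD (hlen ▸ hi)
    rw [hlen] at hmix
    simpa [σ, hmix, hlen] using hs

/-- If `l` extracts the left half, `l⌢(p ⊕ s)` lies in `{p}^+` for every `s` not computable from
`p`. The reduction sends it to some `e⌢q` with `Φ_e(q) = p'`, which the universal functional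
evaluates uniformly. -/
theorem turingLE_of_medvedevSucc_wle {p p' : Baire}
    (h : WLE (idOn (medvedevSucc p)) (idOn (medvedevSucc p'))) : TuringLE p' p := by
  obtain ⟨d, hd⟩ := idOn_wle_iff.1 h
  obtain ⟨l, hl⟩ := exists_Phi_evens
  obtain ⟨r, hr⟩ := exists_Phi_odds
  obtain ⟨u, hu⟩ := exists_Phi_universal
  obtain ⟨c, hc⟩ := exists_Phi_cons l
  obtain ⟨k₁, hk₁⟩ := exists_Phi_comp d c
  obtain ⟨k₂, hk₂⟩ := exists_Phi_comp u k₁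
  refine turingLE_of_forall_join (e := k₂) fun s hs => ?_
  obtain ⟨x, hx, hxd⟩ := hd (cons l (join p s)) ⟨l, _, rfl, hl p s, fun hle =>
    hs (.trans (turingLE_iff.2 ⟨r, hr p s⟩) hle)⟩
  obtain ⟨e, q, rfl, hq, -⟩ := mem_dom_idOn.1 hxd
  exact hk₂ (hk₁ (hc _) hx) (hu hq)

theorem idOn_singleton_wle {p p' : Baire} (h : TuringLE p' p) : WLE (idOn {p}) (idOn {p'}) := by
  obtain ⟨e, he⟩ := turingLE_iff.1 h
  exact idOn_wle_iff.2 ⟨e, fun x hx => ⟨p', Set.mem_singleton_iff.1 hx ▸ he, mem_dom_idOn.2 rfl⟩⟩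

end Weihrauch

open Weihrauch in
theorem mainTheorem2 :
    (∀ f h : Problem, IsStrongMinimalCover f h ↔
      ∃ p : Baire, WEquiv f (idOn {p}) ∧ WEquiv h (idOn (medvedevSucc p))) ∧
    (∀ f h : Problem, IsStrongMinimalCover f h → WLE f idProblem) ∧
    (∀ f g h : Problem, IsStrongMinimalCover f h → IsStrongMinimalCover g h →
      WEquiv f g) := by
  refine ⟨fun f h => isStrongMinimalCover_iff, fun f h H => ?_, fun f g h Hf Hg => ?_⟩
  · obtain ⟨p, hp⟩ := H.exists_wequiv_idOn
    obtain ⟨e, he⟩ := exists_Phi_id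
    exact hp.1.trans (idOn_wle_iff.2 ⟨e, fun x _ => ⟨x, he x, x, rfl⟩⟩)
  · obtain ⟨p, hfp, hhp⟩ := isStrongMinimalCover_iff.1 Hf
    obtain ⟨p', hgp, hhp'⟩ := isStrongMinimalCover_iff.1 Hg
    have hs : WEquiv (idOn (medvedevSucc p)) (idOn (medvedevSucc p')) := hhp.symm.trans hhp'
    exact hfp.trans (.trans ⟨idOn_singleton_wle (turingLE_of_medvedevSucc_wle hs.1),
      idOn_singleton_wle (turingLE_of_medvedevSucc_wle hs.2)⟩ hgp.symm)
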